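/- An \emph{interior algebra} is a Boolean algebra $B$ with an operator $g\colon B\to B$ such that $g(a)\le a$, $g(g(a))=g(a)$, $g(a\cdot b)=g(a)\cdot g(b)$ and $g(1)=1$; an element $a$ is \emph{open} if $g(a)=a$. The open elements of $B$ form a Heyting algebra $\mathcal O(B)$, a bounded sublattice of $B$ with implication $a\Rightarrow b=g(-a+b)$. Let $B^*$ denote the (interior) subalgebra of $B$ generated by the open elements of $B$; $B$ is a \emph{$*$-algebra} if $B=B^*$. For a variety $\mathbf V$ of interior algebras (a class closed under homomorphic images, subalgebras and direct products), let $\gamma(\mathbf V)=\{\mathcal O(A): A\in\mathbf V\}$ (up to isomorphism), and let $\mathbf V^*$ be the variety generated by the $*$-algebras in $\mathbf V$. An algebra $P$ is \emph{projective} in a class $\mathbf K$ of algebras if $P\in\mathbf K$ and for all $A,C\in\mathbf K$, every surjective homomorphism $f\colon A\to C$ and every homomorphism $h\colon P\to C$ there is a homomorphism $k\colon P\to A$ with $f\circ k=h$. Let $\mathbf V$ be a variety of interior algebras and $B\in\mathbf V$. Then $\mathcal O(B)$ is projective in $\gamma(\mathbf V)$ if and only if $B^*$ is projective in $\mathbf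 V^*$. -/

import Mathlib

universe u v

/-- An interior algebra: a Boolean algebra with an interior operator `g`. -/
class InteriorAlgebra (α : Type u) extends BooleanAlgebra α where
  /-- the interior operator -/
  g : α → α
  g_le : ∀ a, g a ≤ a
  g_g : ∀ a, g (g a) = g a
  g_inf : ∀ a b, g (a ⊓ b) = g a ⊓ g b
  g_top : g ⊤ = ⊤

namespace InteriorAlgebra

theorem g_mono {α : Type u} [InteriorAlgebra α] {a b : α} (h : a ≤ b) : g a ≤ g b := by
  rw [← inf_eq_left, ← g_inf, inf_eq_left.mpr h]

/-- Direct products of interior algebras, with pointwise operations. -/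
instance instPi {ι : Type v} (A : ι → Type u) [∀ i, InteriorAlgebra (A i)] :
    InteriorAlgebra (∀ i, A i) where
  g a := fun i => g (a i)
  g_le a := fun i => g_le (a i)
  g_g a := funext fun i => g_g (a i)
  g_inf a b := funext fun i => g_inf (a i) (b i)
  g_top := funext fun _ => g_top

end InteriorAlgebra

open InteriorAlgebra in
/-- Homomorphisms of interior algebras. (Complements are preserved automatically by a
`BoundedLatticeHom` between Boolean algebras.) -/
structure InteriorHom (α : Type u) (β : Type v) [InteriorAlgebra α] [InteriorAlgebra β]
    extends BoundedLatticeHom α β where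
  map_g' : ∀ a, toFun (g a) = g (toFun a)

instance InteriorHom.instFunLike (α : Type u) (β : Type v) [InteriorAlgebra α]
    [InteriorAlgebra β] : FunLike (InteriorHom α β) α β where
  coe f := f.toFun
  coe_injective f h e := by
    obtain ⟨f, _⟩ := f
    obtain ⟨h, _⟩ := h
    have : f = h := DFunLike.coe_injective e
    subst this
    rfl

open InteriorAlgebra in
/-- Subalgebras of an interior algebra. -/
structure InteriorSubalgebra (α : Type u) [InteriorAlgebra α] extends BooleanSubalgebra α where
  g_mem' : ∀ {a}, a ∈ carrier → g a ∈ carrier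

namespace InteriorSubalgebra

open InteriorAlgebra

variable {α : Type u} [InteriorAlgebra α]

instance instSetLike : SetLike (InteriorSubalgebra α) α where
  coe S := S.carrier
  coe_injective S T h := by
    obtain ⟨S, _⟩ := S
    obtain ⟨T, _⟩ := T
    have : S = T := SetLike.coe_injective h
    subst this
    rfl

/-- A subalgebra is an interior algebra under the restricted operations. -/
instance instInteriorAlgebra (S : InteriorSubalgebra α) : InteriorAlgebra S where
  toBooleanAlgebra := BooleanSubalgebra.instBooleanAlgebraCoe S.toBooleanSubalgebra
  g a := ⟨g a.1, S.g_mem' a.2⟩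
  g_le a := g_le a.1
  g_g a := Subtype.ext (g_g a.1)
  g_inf a b := Subtype.ext (g_inf a.1 b.1)
  g_top := Subtype.ext g_top

/-- The subalgebra generated by a set: the intersection of all subalgebras containing it. -/
def closure (s : Set α) : InteriorSubalgebra α where
  carrier := {x | ∀ S : InteriorSubalgebra α, s ⊆ S → x ∈ S}
  supClosed' := fun _ ha _ hb S hS => S.supClosed' (ha S hS) (hb S hS)
  infClosed' := fun _ ha _ hb S hS => S.infClosed' (ha S hS) (hb S hS)
  compl_mem' := fun ha S hS => S.compl_mem' (ha S hS)
  bot_mem' := fun S _ => S.bot_mem'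
  g_mem' := fun ha S hS => S.g_mem' (ha S hS)

end InteriorSubalgebra

namespace InteriorAlgebra

variable (α : Type u) [InteriorAlgebra α]

/-- The bounded sublattice of open elements, i.e. of those `a` with `g a = a`. -/
def openElements : Sublattice α where
  carrier := {a | g a = a}
  supClosed' := by
    intro a ha b hb
    refine le_antisymm (g_le _) (sup_le ?_ ?_)
    · exact (Eq.ge ha).trans (g_mono le_sup_left)
    · exact (Eq.ge hb).trans (g_mono le_sup_right)
  infClosed' := by
    intro a ha b hb
    change g (a ⊓ b) = a ⊓ b
    rw [g_inf, show g a = a from ha, show g b = b from hb]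

instance instBoundedOrderOpen : BoundedOrder (openElements α) where
  top := ⟨⊤, g_top⟩
  bot := ⟨⊥, le_bot_iff.mp (g_le ⊥)⟩
  le_top a := (le_top : a.1 ≤ ⊤)
  bot_le a := (bot_le : ⊥ ≤ a.1)

/-- The open elements form a Heyting algebra with `a ⇨ b = g (aᶜ ⊔ b)`. -/
instance instHeytingAlgebraOpen : HeytingAlgebra (openElements α) :=
  HeytingAlgebra.ofHImp (fun a b => ⟨g (a.1ᶜ ⊔ b.1), g_g _⟩) (by
    intro a b c
    change a.1 ≤ g (b.1ᶜ ⊔ c.1) ↔ a.1 ⊓ b.1 ≤ c.1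
    have key : a.1 ≤ b.1ᶜ ⊔ c.1 ↔ a.1 ⊓ b.1 ≤ c.1 := by
      rw [sup_comm, ← himp_eq, le_himp_iff]
    rw [← key]
    refine ⟨fun h => h.trans (g_le _), fun h => ?_⟩
    exact (Eq.ge a.2).trans (g_mono h))

/-- `B*`: the subalgebra of `B` generated by the open elements of `B`. -/
def star : InteriorSubalgebra α := InteriorSubalgebra.closure (openElements α : Set α)

/-- A `*`-algebra is an interior algebra generated by its open elements. -/
def IsStarAlgebra : Prop := ∀ a : α, a ∈ star α

end InteriorAlgebra

/-- Bundled interior algebras. -/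
structure InteriorAlg where
  carrier : Type u
  [str : InteriorAlgebra carrier]

attribute [instance] InteriorAlg.str

instance : CoeSort InteriorAlg.{u} (Type u) := ⟨InteriorAlg.carrier⟩

/-- The functor `𝒪` on objects: the Heyting algebra of open elements. -/
def InteriorAlg.O (B : InteriorAlg.{u}) : HeytAlg.{u} := HeytAlg.of (InteriorAlgebra.openElements B)

/-- `B*` as an interior algebra. -/
def InteriorAlg.star (B : InteriorAlg.{u}) : InteriorAlg.{u} := ⟨InteriorAlgebra.star B⟩

/-- A variety of interior algebras: a class of interior algebras closed under homomorphic images,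
subalgebras and direct products (the empty product included). -/
structure IsInteriorVariety (V : InteriorAlg.{u} → Prop) : Prop where
  image : ∀ (A C : InteriorAlg.{u}) (f : InteriorHom A C), Function.Surjective f → V A → V C
  subalgebra : ∀ (A : InteriorAlg.{u}) (S : InteriorSubalgebra A), V A → V ⟨S⟩
  product : ∀ (ι : Type u) (A : ι → InteriorAlg.{u}), (∀ i, V (A i)) → V ⟨∀ i, A i⟩

/-- The variety generated by a class of interior algebras. -/
def generatedVariety (K : InteriorAlg.{u} → Prop) : InteriorAlg.{u} → Prop := fun A =>
  ∀ W : InteriorAlg.{u} → Prop, IsInteriorVariety W → (∀ C, K C → W C) → W A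

/-- `V*`: the variety generated by the `*`-algebras in `V`. -/
def starVariety (V : InteriorAlg.{u} → Prop) : InteriorAlg.{u} → Prop :=
  generatedVariety fun A => V A ∧ InteriorAlgebra.IsStarAlgebra A

/-- `γ(V) = {𝒪(A) : A ∈ V}`, up to isomorphism. (An order isomorphism of Heyting algebras is the
same thing as an isomorphism of Heyting algebras.) -/
def gammaClass (V : InteriorAlg.{u} → Prop) : HeytAlg.{u} → Prop := fun L =>
  ∃ A : InteriorAlg.{u}, V A ∧ Nonempty (L ≃o A.O)

/-- `P` is projective in the class `K` of interior algebras: `P ∈ K`, and every homomorphism from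
`P` to a member of `K` lifts along every surjective homomorphism between members of `K`. -/
def InteriorAlg.IsProjectiveIn (K : InteriorAlg.{u} → Prop) (P : InteriorAlg.{u}) : Prop :=
  K P ∧ ∀ A C : InteriorAlg.{u}, K A → K C →
    ∀ f : InteriorHom A C, Function.Surjective f →
      ∀ h : InteriorHom P C, ∃ k : InteriorHom P A, ∀ x, f (k x) = h x

/-- `P` is projective in the class `K` of Heyting algebras: `P ∈ K`, and every homomorphism from
`P` to a member of `K` lifts along every surjective homomorphism between members of `K`. -/
def HeytAlg.IsProjectiveIn (K : HeytAlg.{u} → Prop) (P : HeytAlg.{u}) : Prop :=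
  K P ∧ ∀ A C : HeytAlg.{u}, K A → K C →
    ∀ f : HeytingHom A C, Function.Surjective f →
      ∀ h : HeytingHom P C, ∃ k : HeytingHom P A, ∀ x, f (k x) = h x

/-! Every Heyting homomorphism `φ : 𝒪(A) → 𝒪(C)` extends to an interior homomorphism `A* → C`
(`exists_extension`). Its graph is the Boolean subalgebra of `A × C` generated by the graph of `φ`:
joins of differences of pairs `(a, φ a)`. The interior of the complement of such a join is a meet of
implications `a ⇨ b`, which `φ` preserves; hence the subalgebra is single-valued and closed under
`g`. Since `A*` has the same open elements as `A`, lifting problems for `𝒪(B)` and for `B*`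
translate into each other. -/

instance InteriorHom.instBoundedLatticeHomClass (α : Type u) (β : Type v) [InteriorAlgebra α]
    [InteriorAlgebra β] : BoundedLatticeHomClass (InteriorHom α β) α β where
  map_sup f := f.map_sup'
  map_inf f := f.map_inf'
  map_top f := f.map_top'
  map_bot f := f.map_bot'

namespace InteriorAlgebra

section OpenElements

variable {α : Type u} [InteriorAlgebra α]

theorem g_mem_openElements (a : α) : g a ∈ openElements α := g_g a

theorem coe_himp_openElements (a b : openElements α) :
    ((a ⇨ b : openElements α) : α) = g ((a : α)ᶜ ⊔ b) := rfl

theorem coe_top_openElements : ((⊤ : openElements α) : α) = ⊤ := rfl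

end OpenElements

section Star

variable {α : Type u} [InteriorAlgebra α]

theorem mem_star_of_mem_openElements {a : α} (ha : a ∈ openElements α) : a ∈ star α :=
  fun _ hS => hS ha

theorem sup_mem_star {a b : α} (ha : a ∈ star α) (hb : b ∈ star α) : a ⊔ b ∈ star α :=
  (star α).supClosed' ha hb

theorem compl_mem_star {a : α} (ha : a ∈ star α) : aᶜ ∈ star α :=
  (star α).compl_mem' ha

/-- Since interiors are open, `B*` is already generated by the open elements as a Boolean
algebra. -/
@[elab_as_elim]
theorem star_induction {p : ∀ a : α, a ∈ star α → Prop}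
    (isOpen : ∀ a (ha : a ∈ openElements α), p a (mem_star_of_mem_openElements ha))
    (sup : ∀ a ha b hb, p a ha → p b hb → p (a ⊔ b) (sup_mem_star ha hb))
    (compl : ∀ a ha, p a ha → p aᶜ (compl_mem_star ha))
    {a : α} (ha : a ∈ star α) : p a ha :=
  have inf ⦃x hx y hy⦄ (hx' : p x hx) (hy' : p y hy) :
      p (x ⊓ y) ((star α).infClosed' hx hy) := by
    simpa using compl _ _ (sup _ _ _ _ (compl _ _ hx') (compl _ _ hy'))
  let S : InteriorSubalgebra α :=
    { carrier := {x | ∃ hx, p x hx}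
      supClosed' := fun _ ⟨_, hx⟩ _ ⟨_, hy⟩ => ⟨_, sup _ _ _ _ hx hy⟩
      infClosed' := fun _ ⟨_, hx⟩ _ ⟨_, hy⟩ => ⟨_, inf hx hy⟩
      bot_mem' := ⟨_, isOpen _ (⊥ : openElements α).2⟩
      compl_mem' := fun ⟨_, hx⟩ => ⟨_, compl _ _ hx⟩
      g_mem' := fun _ => ⟨_, isOpen _ (g_mem_openElements _)⟩ }
  (ha S fun x hx => ⟨mem_star_of_mem_openElements hx, isOpen x hx⟩).2

variable (α) in
theorem isStarAlgebra_star : IsStarAlgebra (star α) := by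
  rintro ⟨a, ha⟩
  induction ha using star_induction with
  | isOpen a ha => exact mem_star_of_mem_openElements (Subtype.ext ha)
  | sup a ha b hb iha ihb => exact sup_mem_star iha ihb
  | compl a ha iha => exact compl_mem_star iha

variable (α) in
/-- The inclusion of `B*` into `B`. -/
def starInclusion : InteriorHom (star α) α where
  toFun a := a
  map_sup' _ _ := rfl
  map_inf' _ _ := rfl
  map_top' := rfl
  map_bot' := rfl
  map_g' _ := rfl

variable (α) in
/-- Every open element of `B` is an open element of `B*`. -/
def openToStar : HeytingHom (openElements α) (openElements (star α)) where
  toFun a := ⟨⟨a, mem_star_of_mem_openElements a.2⟩, Subtype.ext a.2⟩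
  map_sup' _ _ := rfl
  map_inf' _ _ := rfl
  map_bot' := rfl
  map_himp' _ _ := rfl

end Star

end InteriorAlgebra

/-! ### Homomorphisms and open elements -/

namespace InteriorHom

open InteriorAlgebra

variable {α : Type u} {β : Type v} [InteriorAlgebra α] [InteriorAlgebra β]

theorem map_g (f : InteriorHom α β) (a : α) : f (g a) = g (f a) := f.map_g' a

theorem map_mem_openElements (f : InteriorHom α β) {a : α} (ha : a ∈ openElements α) :
    f a ∈ openElements β :=
  (f.map_g a).symm.trans (congrArg f ha)

/-- The functor `𝒪` on morphisms. -/
def mapOpen (f : InteriorHom α β) : HeytingHom (openElements α) (openElements β) where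
  toFun a := ⟨f a, f.map_mem_openElements a.2⟩
  map_sup' a b := Subtype.ext (map_sup f (a : α) b)
  map_inf' a b := Subtype.ext (map_inf f (a : α) b)
  map_bot' := Subtype.ext (map_bot f)
  map_himp' a b := Subtype.ext <| by
    change f (g ((a : α)ᶜ ⊔ b)) = g ((f a)ᶜ ⊔ f b)
    rw [map_g, map_sup, map_compl']

/-- A preimage of an open element need not be open, but its interior is an open preimage. -/
theorem mapOpen_surjective {f : InteriorHom α β} (hf : Function.Surjective f) :
    Function.Surjective f.mapOpen := by
  rintro ⟨b, hb⟩
  obtain ⟨a, rfl⟩ := hf b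
  exact ⟨⟨g a, g_mem_openElements a⟩, Subtype.ext ((f.map_g a).trans hb)⟩

/-- If the target is a `*`-algebra, a homomorphism hitting all open elements is surjective. -/
theorem surjective_of_openElements (hβ : IsStarAlgebra β) (f : InteriorHom α β)
    (hf : ∀ b ∈ openElements β, ∃ a, f a = b) : Function.Surjective f := by
  intro b
  induction hβ b using star_induction with
  | isOpen b hb => exact hf b hb
  | sup b _ c _ ihb ihc =>
    obtain ⟨x, rfl⟩ := ihb
    obtain ⟨y, rfl⟩ := ihc
    exact ⟨x ⊔ y, map_sup f x y⟩
  | compl b _ ihb =>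
    obtain ⟨x, rfl⟩ := ihb
    exact ⟨xᶜ, map_compl' f x⟩

/-- Homomorphisms out of a `*`-algebra are determined by their values on open elements. -/
theorem apply_eq_of_openElements {γ : Type*} [InteriorAlgebra γ] (hα : IsStarAlgebra α)
    (f : InteriorHom β γ) (k : InteriorHom α β) (h : InteriorHom α γ)
    (hfk : ∀ a ∈ openElements α, f (k a) = h a) (a : α) : f (k a) = h a := by
  induction hα a using star_induction with
  | isOpen a ha => exact hfk a ha
  | sup a _ b _ iha ihb => rw [map_sup, map_sup, map_sup, iha, ihb]
  | compl a _ iha => rw [map_compl', map_compl', map_compl', iha]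

end InteriorHom

/-! ### Extending Heyting homomorphisms to `B*` -/

namespace InteriorAlgebra

section Extension

variable {α : Type u} {β : Type v} [InteriorAlgebra α] [InteriorAlgebra β]
  (φ : HeytingHom (openElements α) (openElements β))

/-- The graph of `φ`, as a subset of `α × β`. -/
def openGraph : Set (α × β) := Set.range fun a : openElements α => ((a : α), (φ a : β))

theorem isSublattice_openGraph : IsSublattice (openGraph φ) where
  supClosed := by
    rintro _ ⟨a, rfl⟩ _ ⟨b, rfl⟩
    exact ⟨a ⊔ b, Prod.ext rfl (congrArg Subtype.val (map_sup φ a b))⟩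
  infClosed := by
    rintro _ ⟨a, rfl⟩ _ ⟨b, rfl⟩
    exact ⟨a ⊓ b, Prod.ext rfl (congrArg Subtype.val (map_inf φ a b))⟩

theorem bot_mem_openGraph : ⊥ ∈ openGraph φ :=
  ⟨⊥, Prod.ext rfl (congrArg Subtype.val (map_bot φ))⟩

theorem top_mem_openGraph : ⊤ ∈ openGraph φ :=
  ⟨⊤, Prod.ext rfl (congrArg Subtype.val (map_top φ))⟩

/-- The Boolean subalgebra of `α × β` generated by the graph of `φ`. It is the graph of the
extension of `φ` to `B*`. -/
def extensionGraph : BooleanSubalgebra (α × β) := BooleanSubalgebra.closure (openGraph φ)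

variable {φ}

theorem mem_extensionGraph_of_open (a : openElements α) :
    ((a : α), (φ a : β)) ∈ extensionGraph φ :=
  BooleanSubalgebra.subset_closure ⟨a, rfl⟩

/-- The only place where preservation of implication by `φ` is essential: `g (a \ b)ᶜ = a ⇨ b` for
open `a`, `b`, and joins of differences turn into meets of implications. -/
theorem exists_open_of_mem_extensionGraph {p : α × β} (hp : p ∈ extensionGraph φ) :
    ∃ u : openElements α, (u : α) = g p.1ᶜ ∧ (φ u : β) = g p.2ᶜ := by
  induction p, hp using BooleanSubalgebra.closure_sdiff_sup_induction
    (isSublattice_openGraph φ) (bot_mem_openGraph φ) (top_mem_openGraph φ) with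
  | sdiff x hx y hy =>
    obtain ⟨a, rfl⟩ := hx
    obtain ⟨b, rfl⟩ := hy
    refine ⟨a ⇨ b, ?_, ?_⟩
    · simp [coe_himp_openElements, sdiff_eq]
    · simp [coe_himp_openElements, sdiff_eq]
  | sup x hx y hy ihx ihy =>
    obtain ⟨u, hu, hu'⟩ := ihx
    obtain ⟨w, hw, hw'⟩ := ihy
    refine ⟨u ⊓ w, ?_, ?_⟩
    · rw [Prod.fst_sup, compl_sup, g_inf, ← hu, ← hw]; rfl
    · rw [Prod.snd_sup, compl_sup, g_inf, ← hu', ← hw', map_inf]; rfl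

theorem snd_eq_bot_of_mem_extensionGraph {b : β} (h : ((⊥ : α), b) ∈ extensionGraph φ) :
    b = ⊥ := by
  obtain ⟨u, hu, hu'⟩ := exists_open_of_mem_extensionGraph h
  -- Thus `g bᶜ = φ ⊤ = ⊤`, which forces `bᶜ = ⊤`.
  have hu_top : u = ⊤ := Subtype.ext (hu.trans (by rw [compl_bot]; exact g_top))
  rw [hu_top, map_top, coe_top_openElements] at hu'
  exact compl_eq_top.mp (top_le_iff.mp (hu'.le.trans (g_le _)))

theorem extensionGraph_le {a : α} {b c : β} (hb : (a, b) ∈ extensionGraph φ)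
    (hc : (a, c) ∈ extensionGraph φ) : b ≤ c := by
  have h : ((⊥ : α), b \ c) ∈ extensionGraph φ := by
    rw [← sdiff_self (a := a)]
    exact BooleanSubalgebra.sdiff_mem hb hc
  exact sdiff_eq_bot_iff.mp (snd_eq_bot_of_mem_extensionGraph h)

theorem extensionGraph_unique {a : α} {b c : β} (hb : (a, b) ∈ extensionGraph φ)
    (hc : (a, c) ∈ extensionGraph φ) : b = c :=
  le_antisymm (extensionGraph_le hb hc) (extensionGraph_le hc hb)

theorem g_mem_extensionGraph {a : α} {b : β} (h : (a, b) ∈ extensionGraph φ) :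
    (g a, g b) ∈ extensionGraph φ := by
  -- Passing to the complement cancels the one inside `g`, so `(g a, g b)` is a pair `(u, φ u)`.
  obtain ⟨u, hu, hu'⟩ := exists_open_of_mem_extensionGraph (BooleanSubalgebra.compl_mem h)
  have := mem_extensionGraph_of_open (φ := φ) u
  rw [hu, hu'] at this
  simpa using this

variable (φ) in
theorem exists_mem_extensionGraph {a : α} (ha : a ∈ star α) :
    ∃ b : β, (a, b) ∈ extensionGraph φ := by
  induction ha using star_induction with
  | isOpen a ha => exact ⟨_, mem_extensionGraph_of_open ⟨a, ha⟩⟩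
  | sup a _ b _ iha ihb =>
    obtain ⟨x, hx⟩ := iha
    obtain ⟨y, hy⟩ := ihb
    exact ⟨x ⊔ y, BooleanSubalgebra.sup_mem hx hy⟩
  | compl a _ iha =>
    obtain ⟨x, hx⟩ := iha
    exact ⟨xᶜ, BooleanSubalgebra.compl_mem hx⟩

/-- A Heyting homomorphism between the algebras of open elements extends to `B*`. -/
theorem exists_extension (φ : HeytingHom (openElements α) (openElements β)) :
    ∃ k : InteriorHom (star α) β, ∀ (a : star α) (ha : (a : α) ∈ openElements α),
      k a = φ ⟨(a : α), ha⟩ := by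
  choose F hF using fun a : star α => exists_mem_extensionGraph φ a.2
  -- In each law both sides lie over the same first coordinate of the graph.
  refine ⟨⟨⟨⟨⟨F, fun a b => ?_⟩, fun a b => ?_⟩, ?_, ?_⟩, fun a => ?_⟩, fun a ha => ?_⟩
  · exact extensionGraph_unique (hF (a ⊔ b)) (BooleanSubalgebra.sup_mem (hF a) (hF b))
  · exact extensionGraph_unique (hF (a ⊓ b)) (BooleanSubalgebra.inf_mem (hF a) (hF b))
  · exact extensionGraph_unique (hF ⊤) BooleanSubalgebra.top_mem
  · exact extensionGraph_unique (hF ⊥) BooleanSubalgebra.bot_mem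
  · exact extensionGraph_unique (hF (g a)) (g_mem_extensionGraph (hF a))
  · exact extensionGraph_unique (hF a) (mem_extensionGraph_of_open ⟨(a : α), ha⟩)

/-- A Heyting homomorphism between the algebras of open elements extends to one from `A*` to
`C*`. -/
theorem exists_star_extension (φ : HeytingHom (openElements α) (openElements β)) :
    ∃ k : InteriorHom (star α) (star β), ∀ a : openElements α,
      k ⟨a, mem_star_of_mem_openElements a.2⟩ = ⟨φ a, mem_star_of_mem_openElements (φ a).2⟩ := by
  obtain ⟨k, hk⟩ := exists_extension ((openToStar β).comp φ)
  exact ⟨k, fun a => hk _ a.2⟩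

end Extension

end InteriorAlgebra

/-! ### Transfer of projectivity -/

section Varieties

open InteriorAlgebra

variable {V : InteriorAlg.{u} → Prop}

theorem of_starVariety (hV : IsInteriorVariety V) {A : InteriorAlg.{u}} (hA : starVariety V A) :
    V A :=
  hA V hV fun _ h => h.1

theorem starVariety_star (hV : IsInteriorVariety V) {A : InteriorAlg.{u}} (hA : V A) :
    starVariety V A.star :=
  fun _ _ h => h _ ⟨hV.subalgebra A _ hA, isStarAlgebra_star A⟩

theorem gammaClass_O {A : InteriorAlg.{u}} (hA : V A) : gammaClass V A.O :=
  ⟨A, hA, ⟨OrderIso.refl _⟩⟩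

theorem isProjectiveIn_star_of_O (hV : IsInteriorVariety V) {B : InteriorAlg.{u}} (hB : V B)
    (hP : HeytAlg.IsProjectiveIn (gammaClass V) B.O) :
    InteriorAlg.IsProjectiveIn (starVariety V) B.star := by
  refine ⟨starVariety_star hV hB, fun A C hA hC f hf h => ?_⟩
  obtain ⟨κ, hκ⟩ := hP.2 A.O C.O (gammaClass_O (of_starVariety hV hA))
    (gammaClass_O (of_starVariety hV hC)) f.mapOpen (InteriorHom.mapOpen_surjective hf)
    (h.mapOpen.comp (openToStar B))
  -- `A` need not be a `*`-algebra; that `B*` is one suffices to check the lift on open elements.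
  obtain ⟨k, hk⟩ := exists_extension (α := B) (β := A) κ
  refine ⟨k, InteriorHom.apply_eq_of_openElements (isStarAlgebra_star B) f k h fun a ha => ?_⟩
  have ha' : (a : B) ∈ openElements B := congrArg Subtype.val ha
  rw [hk a ha']
  exact congrArg Subtype.val (hκ ⟨a, ha'⟩)

/-- The representing algebras `A`, `C` need not lie in `V*`, so the lifting problem is moved to `A*`
and `C*`. -/
theorem isProjectiveIn_O_of_star (hV : IsInteriorVariety V) {B : InteriorAlg.{u}} (hB : V B)
    (hP : InteriorAlg.IsProjectiveIn (starVariety V) B.star) :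
    HeytAlg.IsProjectiveIn (gammaClass V) B.O := by
  refine ⟨gammaClass_O hB, ?_⟩
  rintro L M ⟨A, hA, ⟨eL⟩⟩ ⟨C, hC, ⟨eM⟩⟩ f hf h
  let φ : HeytingHom A.O C.O := (eM : HeytingHom M C.O).comp (f.comp (eL.symm : HeytingHom A.O L))
  let χ : HeytingHom B.O C.O := (eM : HeytingHom M C.O).comp h
  obtain ⟨F, hF⟩ := exists_star_extension (α := A) (β := C) φ
  obtain ⟨H, hH⟩ := exists_star_extension (α := B) (β := C) χ
  have hF_surj : Function.Surjective F := by
    refine InteriorHom.surjective_of_openElements (isStarAlgebra_star C) F fun c hc => ?_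
    let c' : C.O := (starInclusion C).mapOpen ⟨c, hc⟩
    obtain ⟨l, hl⟩ := hf (eM.symm c')
    have hφ : eM (f (eL.symm (eL l))) = c' := by
      rw [eL.symm_apply_apply, hl, eM.apply_symm_apply]
    have hφ' : ((φ (eL l)).1 : C) = c := congrArg Subtype.val hφ
    exact ⟨_, (hF (eL l)).trans (Subtype.ext hφ')⟩
  obtain ⟨k, hk⟩ := hP.2 A.star C.star (starVariety_star hV hA) (starVariety_star hV hC)
    F hF_surj H
  let κ : HeytingHom B.O A.O :=
    (starInclusion A).mapOpen.comp ((InteriorHom.mapOpen k).comp (openToStar B))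
  refine ⟨(eL.symm : HeytingHom A.O L).comp κ, fun b => eM.injective (Subtype.ext ?_)⟩
  have h₁ := congrArg Subtype.val (hF (κ b))
  have h₂ := congrArg Subtype.val (hH b)
  exact h₁.symm.trans ((congrArg Subtype.val (hk _)).trans h₂)

end Varieties

theorem mainTheorem7 (V : InteriorAlg.{u} → Prop) (hV : IsInteriorVariety V)
    (B : InteriorAlg.{u}) (hB : V B) :
    HeytAlg.IsProjectiveIn (gammaClass V) B.O ↔
      InteriorAlg.IsProjectiveIn (starVariety V) B.star :=
  ⟨isProjectiveIn_star_of_O hV hB, isProjectiveIn_O_of_star hV hB⟩
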